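/- Let $\Lambda=\mathbb{Z}+\mathbb{Z}i$, let $r\ge 2$, and let $f$ be a $\Lambda$-periodic meromorphic function on $\mathbb{C}$ which, on the torus $\mathbb{C}/\Lambda$, has only one zero, at the class of $a$, and only one pole, at the class of $b$, both of order $r$. Let $\overline{\mathcal N}(f)$ be the desingularized Newton flow of $f$, i.e. the planar flow $$\frac{dz}{dt}=-(1+|f(z)|^{4})^{-1}\,\overline{f'(z)}\,f(z),$$ continued by the value $0$ into the poles of $f$. For $c\in\{a,b\}$ put $$\Psi_c(z)=\sqrt{\sum_{\omega\in\Lambda}|z-c-\omega|^{-(4r-4)}}\qquad(z\notin c+\Lambda),$$ and let $\underline{\mathcal N}(f)$ be the planar flow $$\frac{dz}{dt}=-\Psi_a(z)\Psi_b(z)\,(1+|f(z)|^{4})^{-1}\,\overline{f'(z)}\,f(z),$$ continued by the value $0$ into $(a+\Lambda)\cup(b+\Lambda)$. Then the sums defining $\Psi_a$ and $\Psi_b$ converge for $z\notin a+\Lambda$, respectively $z\notin b+\Lambda$, and: 1. $\underline{\mathcal N}(f)$ is a smooth ($C^\infty$, in the real sense) vector field on $\mathbb{C}$. 2. $\underline{\mathcal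 N}(f)$ and $\overline{\mathcal N}(f)$ have the same phase portrait: up to strictly increasing changes of the time parameter, they have the same maximal trajectories. 3. The attractors (asymptotically stable equilibria) of $\underline{\mathcal N}(f)$ are exactly the zeros of $f$, its repellors (attractors after time reversal) are exactly the poles of $f$, and all of them are hyperbolic: no eigenvalue of the real derivative of the vector field there has real part $0$. -/

import Mathlib

open scoped ContDiff Topology

noncomputable section

namespace NewtonFlow

/-- The pair of periods `(1, i)`. -/
def gaussPeriods : PeriodPair where
  ω₁ := 1
  ω₂ := Complex.I
  indep := by
    rw [LinearIndependent.pair_iff]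
    intro s t h
    have h1 := congrArg Complex.re h
    have h2 := congrArg Complex.im h
    simp at h1 h2
    exact ⟨h1, h2⟩

/-- The lattice `Λ = ℤ + ℤ i`. -/
abbrev Λ : Submodule ℤ ℂ := gaussPeriods.lattice

/-- `f` is an elliptic function for the lattice `Λ = ℤ + ℤ i` which, on the torus `ℂ / Λ`, has only
one zero, at the class of `a`, and only one pole, at the class of `b`, both of order `r`.
The value which the Lean function `f` takes at a pole is irrelevant. -/
structure IsNuclear (f : ℂ → ℂ) (r : ℕ) (a b : ℂ) : Prop where
  meromorphic : ∀ z, MeromorphicAt f z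
  /-- away from the poles, the value of `f` is the true one (no removable singularities) -/
  analytic : ∀ z, 0 ≤ meromorphicOrderAt f z → AnalyticAt ℂ f z
  periodic : ∀ w ∈ Λ, ∀ z, f (z + w) = f z
  order_zero : meromorphicOrderAt f a = ((r : ℤ) : WithTop ℤ)
  order_pole : meromorphicOrderAt f b = ((-(r : ℤ) : ℤ) : WithTop ℤ)
  order_other : ∀ z, z - a ∉ Λ → z - b ∉ Λ → meromorphicOrderAt f z = 0

open Classical in
/-- The desingularized planar Newton flow
`dz/dt = -(1 + |f|⁴)⁻¹ * |f'|² * (f / f') = -(1 + |f|⁴)⁻¹ * conj f' * f` of a meromorphic function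
`f`, continued by `0` into the poles of `f`. -/
def desingularized (f : ℂ → ℂ) (z : ℂ) : ℂ :=
  if meromorphicOrderAt f z < 0 then 0
  else -((((1 + ‖f z‖ ^ 4)⁻¹ : ℝ) : ℂ) * (starRingEnd ℂ) (deriv f z) * f z)

/-- `Ψ_c(z) = (∑_{w ∈ Λ} |z - c - w|^{-(4r-4)})^{1/2}`, used for `z ∉ c + Λ` only. -/
def Psi (r : ℕ) (c z : ℂ) : ℝ :=
  Real.sqrt (∑' w : Λ, ‖z - c - (w : ℂ)‖ ^ (-(4 * (r : ℤ) - 4)))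

open Classical in
/-- The flow `dz/dt = -Ψ_a Ψ_b (1 + |f|⁴)⁻¹ * conj f' * f`, where the formula does not apply
(that is, on `a + Λ` and `b + Λ`) continued by `0`. -/
def rescaled (f : ℂ → ℂ) (r : ℕ) (a b z : ℂ) : ℂ :=
  if z - a ∈ Λ ∨ z - b ∈ Λ then 0
  else ((Psi r a z * Psi r b z : ℝ) : ℂ) * desingularized f z

/-- `γ`, restricted to the open interval `I`, is a maximal trajectory of `dz/dt = X z`. -/
structure IsMaximalTrajectory (X : ℂ → ℂ) (I : Set ℝ) (γ : ℝ → ℂ) : Prop where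
  isOpen : IsOpen I
  ordConnected : I.OrdConnected
  nonempty : I.Nonempty
  integral : IsIntegralCurveOn γ (fun _ => X) I
  maximal : ∀ (J : Set ℝ) (δ : ℝ → ℂ), IsOpen J → J.OrdConnected → I ⊆ J → Set.EqOn δ γ I →
    IsIntegralCurveOn δ (fun _ => X) J → J ⊆ I

/-- Every maximal trajectory of `X` becomes one of `Y` after an orientation preserving change of
its time parameter. -/
def TrajectoriesSubset (X Y : ℂ → ℂ) : Prop :=
  ∀ (I : Set ℝ) (γ : ℝ → ℂ), IsMaximalTrajectory X I γ →
    ∃ (J : Set ℝ) (h : ℝ → ℝ), StrictMonoOn h J ∧ h '' J = I ∧ IsMaximalTrajectory Y J (γ ∘ h)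

/-- `X` and `Y` have the same phase portrait: the same oriented maximal trajectories. -/
def SamePhasePortrait (X Y : ℂ → ℂ) : Prop :=
  TrajectoriesSubset X Y ∧ TrajectoriesSubset Y X

/-- `p` is an attractor, i.e. an asymptotically stable equilibrium, of `dz/dt = X z`. -/
def IsAttractor (X : ℂ → ℂ) (p : ℂ) : Prop :=
  X p = 0 ∧ ∀ U ∈ 𝓝 p, ∃ V ∈ 𝓝 p, ∀ (I : Set ℝ) (γ : ℝ → ℂ), IsMaximalTrajectory X I γ →
    0 ∈ I → γ 0 ∈ V →
      Set.Ici 0 ⊆ I ∧ (∀ t, 0 ≤ t → γ t ∈ U) ∧ Filter.Tendsto γ Filter.atTop (𝓝 p)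

/-- `p` is a repellor: an attractor after reversal of time. -/
def IsRepellor (X : ℂ → ℂ) (p : ℂ) : Prop :=
  IsAttractor (fun z => -X z) p

/-- `p` is a hyperbolic equilibrium of the planar vector field `X`: no eigenvalue of the (real)
derivative of `X` at `p` lies on the imaginary axis. -/
def IsHyperbolic (X : ℂ → ℂ) (p : ℂ) : Prop :=
  X p = 0 ∧ DifferentiableAt ℝ X p ∧
    ∀ μ : ℂ, Polynomial.aeval μ (fderiv ℝ X p).toLinearMap.charpoly = 0 → μ.re ≠ 0

end NewtonFlow

end

/-! Near its zero, `f = (z - a)^r g` with `g a ≠ 0`, so `conj f' * f` equals `|z - a|^(2r-2) (z -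
a)` times a smooth function with value `r |g a|²` at `a`. The term `w = 0` of the lattice sum
dominates there, so `Ψ_a` is `|z - a|^(-(2r-2))` times a smooth function with value `1` at `a`. The
degenerate powers cancel, and the rescaled field is `(z - a) H` with `H` smooth and `H a < 0`
(`IsNuclear.exists_rescaled_eventuallyEq`). This gives smoothness at `a`, and a derivative that is a
negative multiple of the identity, hence a hyperbolic attractor (`isAttractor_of_hasFDerivAt`,
`isHyperbolic_of_hasFDerivAt`). Away from the zeros and poles, smoothness reduces to that of the
lattice sums (`contDiffAt_tsum_inv_norm_pow`).

Poles need no separate analysis: replacing `f` by `1/f` exchanges `a` and `b` and changes the sign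
of both fields (`IsNuclear.reciprocal`, `IsNuclear.rescaled_reciprocal`).

Both fields are smooth and periodic, so they are bounded and globally Lipschitz, and all their
maximal trajectories are defined on `ℝ`. They differ by the positive factor `Ψ_a Ψ_b` off a closed
set of common equilibria, so integrating this factor along a trajectory gives the change of time
(`trajectoriesSubset_of_smul`).

There are no other attractors, because `|f|` does not increase along trajectories off the zeros and
poles. A pole cannot attract, and near any other point where `f` does not vanish the open mapping
theorem yields starting points with smaller `|f|`, whose trajectories cannot converge to that point
(`IsNuclear.sub_mem_of_isAttractor`). -/

namespace NewtonFlow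

open Set Filter

/-! ### Completeness and uniqueness of the flow -/

/-- A vector field that is Lipschitz and bounded; such a field is complete. -/
def LipschitzBounded (X : ℂ → ℂ) : Prop :=
  (∃ K, LipschitzWith K X) ∧ ∃ M : NNReal, ∀ z, ‖X z‖ ≤ M

lemma integralCurve_eqOn {X : ℂ → ℂ} (hX : LipschitzBounded X) {I : Set ℝ} (hI : IsOpen I)
    (hIc : I.OrdConnected) {γ δ : ℝ → ℂ} (hγ : IsIntegralCurveOn γ (fun _ => X) I)
    (hδ : IsIntegralCurveOn δ (fun _ => X) I) {t₀ : ℝ} (ht₀ : t₀ ∈ I) (h : γ t₀ = δ t₀) :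
    EqOn γ δ I := by
  obtain ⟨⟨K, hK⟩, -⟩ := hX
  have hγ' : ∀ t ∈ I, HasDerivAt γ (X (γ t)) t := fun t ht =>
    (hγ t ht).hasDerivAt (hI.mem_nhds ht)
  have hδ' : ∀ t ∈ I, HasDerivAt δ (X (δ t)) t := fun t ht =>
    (hδ t ht).hasDerivAt (hI.mem_nhds ht)
  intro t ht
  rcases le_total t₀ t with htt | htt
  · have hs : Icc t₀ t ⊆ I := hIc.out ht₀ ht
    exact ODE_solution_unique (v := fun _ => X) (fun _ => hK)
      (fun s hs' => (hγ' s (hs hs')).continuousAt.continuousWithinAt)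
      (fun s hs' => (hγ' s (hs (Ico_subset_Icc_self hs'))).hasDerivWithinAt)
      (fun s hs' => (hδ' s (hs hs')).continuousAt.continuousWithinAt)
      (fun s hs' => (hδ' s (hs (Ico_subset_Icc_self hs'))).hasDerivWithinAt) h ⟨htt, le_rfl⟩
  · have hs : Icc t t₀ ⊆ I := hIc.out ht ht₀
    exact ODE_solution_unique_of_mem_Icc_left (v := fun _ => X) (s := fun _ => univ)
      (fun _ _ => hK.lipschitzOnWith)
      (fun s hs' => (hγ' s (hs hs')).continuousAt.continuousWithinAt)
      (fun s hs' => (hγ' s (hs (Ioc_subset_Icc_self hs'))).hasDerivWithinAt) (fun _ _ => trivial)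
      (fun s hs' => (hδ' s (hs hs')).continuousAt.continuousWithinAt)
      (fun s hs' => (hδ' s (hs (Ioc_subset_Icc_self hs'))).hasDerivWithinAt) (fun _ _ => trivial)
      h ⟨le_rfl, htt⟩

lemma integralCurve_eq {X : ℂ → ℂ} (hX : LipschitzBounded X) {γ δ : ℝ → ℂ}
    (hγ : IsIntegralCurve γ (fun _ => X)) (hδ : IsIntegralCurve δ (fun _ => X)) {t₀ : ℝ}
    (h : γ t₀ = δ t₀) : γ = δ :=
  funext fun t => integralCurve_eqOn hX isOpen_univ ordConnected_univ
    (hγ.isIntegralCurveOn univ) (hδ.isIntegralCurveOn univ) (mem_univ t₀) h (mem_univ t)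

lemma integralCurve_const {X : ℂ → ℂ} (hX : LipschitzBounded X) {γ : ℝ → ℂ}
    (hγ : IsIntegralCurve γ (fun _ => X)) {t₀ : ℝ} (h : X (γ t₀) = 0) (t : ℝ) : γ t = γ t₀ := by
  have hc : IsIntegralCurve (fun _ : ℝ => γ t₀) (fun _ => X) := fun t => by
    simpa [h] using hasDerivAt_const t (γ t₀)
  exact congrFun (integralCurve_eq hX hγ hc (t₀ := t₀) rfl) t

lemma exists_integralCurve {X : ℂ → ℂ} (hX : LipschitzBounded X) (t₀ : ℝ) (x₀ : ℂ) :
    ∃ γ : ℝ → ℂ, γ t₀ = x₀ ∧ IsIntegralCurve γ (fun _ => X) := by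
  have key : ∀ n : ℕ, ∃ α : ℝ → ℂ, α t₀ = x₀ ∧
      IsIntegralCurveOn α (fun _ => X) (Ioo (t₀ - (n + 1)) (t₀ + (n + 1))) := by
    intro n
    obtain ⟨⟨K, hK⟩, M, hM⟩ := hX
    have hn : (0 : ℝ) ≤ n + 1 := by positivity
    -- A speed at most `M` moves a point by at most `M * (n + 1)` in time `n + 1`; with this radius
    -- the Picard–Lindelöf condition holds on intervals of any length.
    have hp : IsPicardLindelof (fun _ => X) (tmin := t₀ - (n + 1)) (tmax := t₀ + (n + 1))
        ⟨t₀, by constructor <;> linarith⟩ x₀ (M * ((n : NNReal) + 1)) 0 M K := by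
      refine IsPicardLindelof.of_time_independent (fun z _ => hM z) hK.lipschitzOnWith ?_
      simp
    obtain ⟨α, h0, hα⟩ := hp.exists_eq_forall_mem_Icc_hasDerivWithinAt₀
    exact ⟨α, h0, fun t ht => (hα t (Ioo_subset_Icc_self ht)).mono Ioo_subset_Icc_self⟩
  choose α hα0 hα using key
  have hmem : ∀ (n : ℕ) (t : ℝ), |t - t₀| < n + 1 ↔
      t ∈ Ioo (t₀ - ((n : ℝ) + 1)) (t₀ + (n + 1)) := fun n t => by
    rw [abs_lt, mem_Ioo]
    constructor <;> rintro ⟨h1, h2⟩ <;> constructor <;> linarith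
  have hmono : ∀ (m n : ℕ), m ≤ n → ∀ t, |t - t₀| < m + 1 → α m t = α n t := by
    intro m n hmn t ht
    have hmn' : (m : ℝ) ≤ n := by exact_mod_cast hmn
    refine integralCurve_eqOn hX isOpen_Ioo ordConnected_Ioo (hα m) ((hα n).mono ?_)
      (t₀ := t₀) ?_ ((hα0 m).trans (hα0 n).symm) ((hmem m t).1 ht)
    · exact Ioo_subset_Ioo (by linarith) (by linarith)
    · rw [← hmem]
      simp
      positivity
  -- The local solutions agree on overlaps, so any index large enough for `t` may be used. The `+ 1`
  -- in the half-length keeps `t` in the interior of the interval of index `⌈|t - t₀|⌉₊`.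
  refine ⟨fun t => α ⌈|t - t₀|⌉₊ t, hα0 _, fun t => ?_⟩
  set N := ⌈|t - t₀|⌉₊ with hN
  have ht : |t - t₀| < N + 1 := (Nat.le_ceil _).trans_lt (lt_add_one _)
  have hd : HasDerivAt (α N) (X (α N t)) t :=
    (hα N t ((hmem N t).1 ht)).hasDerivAt (isOpen_Ioo.mem_nhds ((hmem N t).1 ht))
  refine hd.congr_of_eventuallyEq ?_
  filter_upwards [isOpen_Ioo.mem_nhds ((hmem N t).1 ht)] with s hs
  have hs' := (hmem N s).2 hs
  have hs'' : |s - t₀| < ⌈|s - t₀|⌉₊ + 1 := (Nat.le_ceil _).trans_lt (lt_add_one _)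
  rcases le_total ⌈|s - t₀|⌉₊ N with h | h
  · exact hmono _ _ h s hs''
  · exact (hmono _ _ h s hs').symm

lemma isMaximalTrajectory_univ {X : ℂ → ℂ} {γ : ℝ → ℂ} (hγ : IsIntegralCurve γ (fun _ => X)) :
    IsMaximalTrajectory X univ γ :=
  ⟨isOpen_univ, ordConnected_univ, univ_nonempty, hγ.isIntegralCurveOn _,
    fun _ _ _ _ _ _ _ => subset_univ _⟩

lemma IsMaximalTrajectory.eq_univ {X : ℂ → ℂ} (hX : LipschitzBounded X) {I : Set ℝ} {γ : ℝ → ℂ}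
    (h : IsMaximalTrajectory X I γ) : I = univ := by
  obtain ⟨t₀, ht₀⟩ := h.nonempty
  obtain ⟨δ, h0, hδ⟩ := exists_integralCurve hX t₀ (γ t₀)
  exact univ_subset_iff.1 (h.maximal univ δ isOpen_univ ordConnected_univ (subset_univ _)
    (integralCurve_eqOn hX h.isOpen h.ordConnected (hδ.isIntegralCurveOn _) h.integral ht₀ h0)
    (hδ.isIntegralCurveOn _))

lemma IsMaximalTrajectory.isIntegralCurve {X : ℂ → ℂ} (hX : LipschitzBounded X) {I : Set ℝ}
    {γ : ℝ → ℂ} (h : IsMaximalTrajectory X I γ) : IsIntegralCurve γ (fun _ => X) := by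
  rw [← isIntegralCurveOn_univ, ← h.eq_univ hX]
  exact h.integral

/-! ### Change of the time parameter -/

/-- A monotone function either diverges or converges. In the second case its slope would eventually
exceed `c / 2`, so the increments over unit intervals could not tend to `0`. It serves to show that
the new time runs over all of `ℝ`. -/
lemma tendsto_atTop_of_deriv_pos {H ρ : ℝ → ℝ} (hH : ∀ t, HasDerivAt H (ρ t) t)
    (hρ : ∀ t, 0 < ρ t)
    (hlim : ∀ l, Tendsto H atTop (𝓝 l) → ∃ c > 0, Tendsto ρ atTop (𝓝 c)) :
    Tendsto H atTop atTop := by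
  have hmono : Monotone H := monotone_of_deriv_nonneg (fun t => (hH t).differentiableAt)
    fun t => (hH t).deriv ▸ (hρ t).le
  rcases tendsto_atTop_of_monotone hmono with h | ⟨l, hl⟩
  · exact h
  exfalso
  obtain ⟨c, hc, hρc⟩ := hlim l hl
  obtain ⟨T, hT⟩ := eventually_atTop.1 (hρc.eventually (lt_mem_nhds (half_lt_self hc)))
  have h1 : ∀ t ≥ T, c / 2 ≤ H (t + 1) - H t := by
    intro t ht
    have := (convex_Ici T).mul_sub_le_image_sub_of_le_deriv (f := H) (C := c / 2)
      (fun s _ => (hH s).continuousAt.continuousWithinAt)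
      (fun s _ => (hH s).differentiableAt.differentiableWithinAt)
      (fun s hs => (hH s).deriv ▸ (hT s (interior_subset hs)).le) t ht (t + 1)
      (by simp only [mem_Ici]; linarith) (by linarith)
    simpa using this
  have h2 : Tendsto (fun t => H (t + 1) - H t) atTop (𝓝 (l - l)) :=
    (hl.comp (tendsto_atTop_add_const_right _ _ tendsto_id)).sub hl
  have h3 := ge_of_tendsto h2 (eventually_atTop.2 ⟨T, h1⟩)
  linarith

/-- Two complete vector fields that differ by a positive factor off a closed set of common
equilibria have the same oriented trajectories. -/
lemma trajectoriesSubset_of_smul {X Y : ℂ → ℂ} (hX : LipschitzBounded X)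
    (hY : LipschitzBounded Y) {E : Set ℂ} (hE : IsClosed E) {ψ : ℂ → ℝ}
    (hψ : ContinuousOn ψ Eᶜ) (hpos : ∀ z ∉ E, 0 < ψ z) (hXE : ∀ z ∈ E, X z = 0)
    (hYE : ∀ z ∈ E, Y z = 0) (hXY : ∀ z ∉ E, X z = ψ z • Y z) : TrajectoriesSubset X Y := by
  intro I γ hγmax
  have hI := hγmax.eq_univ hX
  have hγ := hγmax.isIntegralCurve hX
  subst hI
  by_cases h0 : γ 0 ∈ E
  · refine ⟨univ, id, strictMono_id.strictMonoOn _, by simp, isMaximalTrajectory_univ fun t => ?_⟩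
    have h := hγ t
    have hc := integralCurve_const hX hγ (hXE _ h0) t
    have h1 : X (γ t) = Y (γ t) := by rw [hc, hXE _ h0, hYE _ h0]
    simpa [h1] using h
  obtain ⟨η, hη0, hη⟩ := exists_integralCurve hY 0 (γ 0)
  -- By uniqueness, a trajectory that meets an equilibrium is constant.
  have hγE : ∀ t, γ t ∉ E := fun t ht =>
    h0 (by rw [integralCurve_const hX hγ (hXE _ ht) 0]; exact ht)
  have hηE : ∀ t, η t ∉ E := fun t ht =>
    h0 (by rw [← hη0, integralCurve_const hY hη (hYE _ ht) 0]; exact ht)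
  have hψat : ∀ z ∉ E, ContinuousAt ψ z := fun z hz => hψ.continuousAt (hE.isOpen_compl.mem_nhds hz)
  set ρ : ℝ → ℝ := fun t => ψ (γ t) with hρdef
  have hρc : Continuous ρ := continuous_iff_continuousAt.2 fun t =>
    (hψat _ (hγE t)).comp hγ.continuous.continuousAt
  have hρpos : ∀ t, 0 < ρ t := fun t => hpos _ (hγE t)
  set H : ℝ → ℝ := fun t => ∫ s in (0 : ℝ)..t, ρ s with hHdef
  have hH : ∀ t, HasDerivAt H (ρ t) t := fun t => hρc.integral_hasStrictDerivAt 0 t |>.hasDerivAt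
  have hHcont : Continuous H := continuous_iff_continuousAt.2 fun t => (hH t).continuousAt
  have hHmono : StrictMono H := strictMono_of_deriv_pos fun t => (hH t).deriv ▸ hρpos t
  have hηH : ∀ t, HasDerivAt (η ∘ H) (ρ t • Y ((η ∘ H) t)) t := fun t =>
    (hη (H t)).scomp t (hH t)
  have hγρ : ∀ t, HasDerivAt γ (ρ t • Y (γ t)) t := fun t => hXY _ (hγE t) ▸ hγ t
  -- Both sides solve the nonautonomous equation `z' = ρ t • Y z`, whose Lipschitz constant is
  -- uniform for `t` in a compact interval.
  have heq : γ = η ∘ H := by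
    funext t
    obtain ⟨⟨K, hK⟩, -⟩ := hY
    obtain ⟨C, hC⟩ := (isCompact_Icc (a := -(|t| + 1)) (b := |t| + 1)).bddAbove_image
      hρc.continuousOn
    have habs := abs_nonneg t
    refine ODE_solution_unique_of_mem_Ioo (v := fun t z => ρ t • Y z) (s := fun _ => univ)
      (K := C.toNNReal * K) (a := -(|t| + 1)) (b := |t| + 1) (t₀ := 0) (fun s hs => ?_)
      ⟨by linarith, by linarith⟩ (fun s _ => ⟨hγρ s, trivial⟩) (fun s _ => ⟨hηH s, trivial⟩)
      (by simp [hHdef, hη0]) ?_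
    · have hs' : ρ s ≤ C := hC (mem_image_of_mem _ (Ioo_subset_Icc_self hs))
      refine LipschitzWith.lipschitzOnWith (LipschitzWith.of_dist_le_mul fun x y => ?_)
      rw [dist_smul₀, Real.norm_of_nonneg (hρpos s).le, NNReal.coe_mul, mul_assoc,
        Real.coe_toNNReal _ ((hρpos s).le.trans hs')]
      have hd := hK.dist_le_mul x y
      have hC0 : 0 ≤ C := (hρpos s).le.trans hs'
      gcongr
    · constructor
      · linarith [neg_abs_le t]
      · linarith [le_abs_self t]
  -- If `H` had a finite limit `l`, then `γ = η ∘ H` would tend to `η l ∉ E`, and `ρ` to the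
  -- positive number `ψ (η l)`.
  have htop : Tendsto H atTop atTop := by
    refine tendsto_atTop_of_deriv_pos hH hρpos fun l hl => ⟨ψ (η l), hpos _ (hηE l), ?_⟩
    have h1 : Tendsto γ atTop (𝓝 (η l)) := by
      rw [heq]
      exact (hη.continuous.tendsto l).comp hl
    exact (hψat _ (hηE l)).tendsto.comp h1
  have hbot' : Tendsto (fun t => -H (-t)) atTop atTop := by
    have hd : ∀ t, HasDerivAt (fun t => -H (-t)) (ρ (-t)) t := fun t => by
      have := ((hH (-t)).comp t (hasDerivAt_neg t)).fun_neg
      simpa using this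
    refine tendsto_atTop_of_deriv_pos hd (fun t => hρpos _) fun l hl =>
      ⟨ψ (η (-l)), hpos _ (hηE _), ?_⟩
    have h1 : Tendsto (fun t => γ (-t)) atTop (𝓝 (η (-l))) := by
      have : (fun t => γ (-t)) = fun t => η (-(-H (-t))) := by
        funext t
        simp [heq]
      rw [this]
      exact (hη.continuous.tendsto (-l)).comp hl.neg
    exact (hψat _ (hηE _)).tendsto.comp h1
  have hbot : Tendsto H atBot atBot := by
    have := (tendsto_neg_atTop_atBot.comp hbot').comp tendsto_neg_atBot_atTop
    simpa [Function.comp_def] using this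
  have hsurj : Function.Surjective H := hHcont.surjective htop hbot
  let e := hHmono.orderIsoOfSurjective H hsurj
  refine ⟨univ, e.symm, e.symm.strictMono.strictMonoOn _, by simp [e.symm.surjective.range_eq], ?_⟩
  have : γ ∘ e.symm = η := by
    funext s
    have hs : H (e.symm s) = s := e.apply_symm_apply s
    simp only [heq, Function.comp_apply, hs]
  rw [this]
  exact isMaximalTrajectory_univ hη

/-! ### Equilibria with scalar linearization -/

/-- A complete vector field with derivative a negative multiple of the identity at an equilibrium
has an attractor there. -/
lemma isAttractor_of_hasFDerivAt {X : ℂ → ℂ} (hX : LipschitzBounded X) {p : ℂ} (hp : X p = 0)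
    {c : ℝ} (hc : 0 < c) (hd : HasFDerivAt X (-c • ContinuousLinearMap.id ℝ ℂ) p) :
    IsAttractor X p := by
  refine ⟨hp, fun U hU => ?_⟩
  -- An error of slope `c / 2` uses up half of the linear contraction; the decay rate left for `‖γ t
  -- - p‖ ^ 2` is `c`.
  have hlin : ∀ᶠ z in 𝓝 p, ‖X z + c • (z - p)‖ ≤ c / 2 * ‖z - p‖ := by
    filter_upwards [hd.isLittleO.bound (half_pos hc)] with z hz
    simpa [hp] using hz
  obtain ⟨ε, hε, hball⟩ := Metric.mem_nhds_iff.1 (inter_mem hU hlin)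
  refine ⟨Metric.ball p (ε / 2), Metric.ball_mem_nhds p (half_pos hε), fun I γ hγmax _ hγ0 => ?_⟩
  have hI := hγmax.eq_univ hX
  have hγ := hγmax.isIntegralCurve hX
  have hder : ∀ t, HasDerivAt (fun t => ‖γ t - p‖ ^ 2) (2 * inner ℝ (γ t - p) (X (γ t))) t :=
    fun t => ((hγ t).sub_const p).norm_sq
  have hineq : ∀ t, ‖γ t - p‖ < ε → 2 * inner ℝ (γ t - p) (X (γ t)) ≤ -c * ‖γ t - p‖ ^ 2 := by
    intro t ht
    have h1 : ‖X (γ t) + c • (γ t - p)‖ ≤ c / 2 * ‖γ t - p‖ :=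
      (hball (mem_ball_iff_norm.2 ht)).2
    have h2 : inner ℝ (γ t - p) (X (γ t) + c • (γ t - p)) ≤
        ‖γ t - p‖ * (c / 2 * ‖γ t - p‖) :=
      (real_inner_le_norm _ _).trans (by gcongr)
    rw [inner_add_right, real_inner_smul_right, real_inner_self_eq_norm_sq] at h2
    nlinarith
  have hstay : ∀ t, 0 ≤ t → ‖γ t - p‖ < ε := by
    intro t ht
    have hle : ‖γ t - p‖ ^ 2 ≤ (ε / 2) ^ 2 := by
      -- On the circle of radius `ε / 2` the squared distance strictly decreases, so the trajectory
      -- cannot leave the disc.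
      refine image_le_of_deriv_right_lt_deriv_boundary' (a := 0) (b := t)
        (f := fun t => ‖γ t - p‖ ^ 2) (f' := fun t => 2 * inner ℝ (γ t - p) (X (γ t)))
        (B := fun _ => (ε / 2) ^ 2) (B' := fun _ => 0)
        (fun s _ => (hder s).continuousAt.continuousWithinAt)
        (fun s _ => (hder s).hasDerivWithinAt) ?_ continuousOn_const
        (fun s _ => hasDerivWithinAt_const _ _ _) (fun s _ hs => ?_) ⟨ht, le_rfl⟩
      · have := mem_ball_iff_norm.1 hγ0
        gcongr
      · have h1 : ‖γ s - p‖ = ε / 2 :=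
          (pow_left_inj₀ (norm_nonneg _) (by positivity) two_ne_zero).1 hs
        refine (hineq s (by linarith)).trans_lt ?_
        rw [h1]
        have : 0 < c * (ε / 2) ^ 2 := by positivity
        linarith
    have := abs_le_of_sq_le_sq hle (by positivity)
    rw [abs_norm] at this
    linarith
  have hanti : AntitoneOn (fun t => ‖γ t - p‖ ^ 2 * Real.exp (c * t)) (Ici 0) := by
    have hd' : ∀ t, HasDerivAt (fun t => ‖γ t - p‖ ^ 2 * Real.exp (c * t))
        (2 * inner ℝ (γ t - p) (X (γ t)) * Real.exp (c * t) +
          ‖γ t - p‖ ^ 2 * (Real.exp (c * t) * c)) t := fun t => by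
      have h1 : HasDerivAt (fun t : ℝ => Real.exp (c * t)) (Real.exp (c * t) * c) t := by
        simpa using ((hasDerivAt_id t).const_mul c).exp
      exact (hder t).mul h1
    refine antitoneOn_of_deriv_nonpos (convex_Ici 0)
      (fun t _ => (hd' t).continuousAt.continuousWithinAt)
      (fun t _ => (hd' t).differentiableAt.differentiableWithinAt) fun t ht => ?_
    rw [(hd' t).deriv]
    have h1 := hineq t (hstay t (interior_subset ht))
    have h2 := Real.exp_pos (c * t)
    nlinarith
  have hbound : ∀ t, 0 ≤ t → ‖γ t - p‖ ^ 2 ≤ ‖γ 0 - p‖ ^ 2 * Real.exp (-(c * t)) := by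
    intro t ht
    have h1 := hanti (mem_Ici.2 le_rfl) (mem_Ici.2 ht) ht
    simp only [mul_zero, Real.exp_zero, mul_one] at h1
    rw [Real.exp_neg, ← div_eq_mul_inv, le_div_iff₀ (Real.exp_pos _)]
    exact h1
  refine ⟨hI ▸ subset_univ _, fun t ht => (hball (mem_ball_iff_norm.2 (hstay t ht))).1, ?_⟩
  have hexp : Tendsto (fun t => ‖γ 0 - p‖ ^ 2 * Real.exp (-(c * t))) atTop (𝓝 0) := by
    have : Tendsto (fun t : ℝ => Real.exp (-(c * t))) atTop (𝓝 0) :=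
      Real.tendsto_exp_neg_atTop_nhds_zero.comp (tendsto_id.const_mul_atTop hc)
    simpa using this.const_mul (‖γ 0 - p‖ ^ 2)
  have hsq : Tendsto (fun t => ‖γ t - p‖ ^ 2) atTop (𝓝 0) :=
    squeeze_zero' (Eventually.of_forall fun t => by positivity)
      (eventually_atTop.2 ⟨0, hbound⟩) hexp
  rw [tendsto_iff_norm_sub_tendsto_zero]
  have := hsq.sqrt
  simpa using this

/-- The spectrum of a nonzero real multiple of the identity of the plane avoids the imaginary
axis. -/
lemma isHyperbolic_of_hasFDerivAt {X : ℂ → ℂ} {p : ℂ} (hp : X p = 0) {c : ℝ} (hc : c ≠ 0)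
    (hd : HasFDerivAt X (c • ContinuousLinearMap.id ℝ ℂ) p) : IsHyperbolic X p := by
  refine ⟨hp, hd.differentiableAt, fun μ hμ => ?_⟩
  rw [hd.fderiv] at hμ
  have hch : (c • ContinuousLinearMap.id ℝ ℂ).toLinearMap.charpoly =
      (Polynomial.X - Polynomial.C c) ^ 2 := by
    have hm : LinearMap.toMatrix Complex.basisOneI Complex.basisOneI
        (c • ContinuousLinearMap.id ℝ ℂ).toLinearMap = c • 1 := by
      rw [ContinuousLinearMap.toLinearMap_smul, map_smul, ContinuousLinearMap.coe_id,
        LinearMap.toMatrix_id]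
    rw [← LinearMap.charpoly_toMatrix _ Complex.basisOneI, Matrix.charpoly_fin_two, hm]
    have h2 : (Polynomial.C 2 : Polynomial ℝ) = 2 := map_ofNat _ 2
    simp [h2]
    ring
  rw [hch] at hμ
  have h1 : μ = c := by
    simpa [sub_eq_zero] using hμ
  rw [h1]
  simpa using hc

/-! ### Smoothness of lattice sums -/

/-- For `‖z‖ ≤ ‖w‖ / 2` one has `‖z - w‖^(-n) = ‖w‖^(-n) G (w⁻¹ z)`, so a single profile with
bounded derivatives controls all distant terms of the lattice sum at once. -/
lemma exists_contDiff_eq_inv_norm_pow (n : ℕ) : ∃ G : ℂ → ℝ, ContDiff ℝ ∞ G ∧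
    HasCompactSupport G ∧ ∀ v, ‖v‖ ≤ 1 / 2 → G v = (‖1 - v‖ ^ n)⁻¹ := by
  let χ : ContDiffBump (0 : ℂ) := ⟨1 / 2, 3 / 4, by norm_num, by norm_num⟩
  refine ⟨fun v => χ v * (‖1 - v‖ ^ n)⁻¹, contDiff_iff_contDiffAt.2 fun v => ?_,
    χ.hasCompactSupport.mul_right, fun v hv => ?_⟩
  · by_cases hv : v = 1
    · refine (contDiffAt_const (c := (0 : ℝ))).congr_of_eventuallyEq ?_
      have hmem : {v : ℂ | 3 / 4 < ‖v‖} ∈ 𝓝 v :=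
        (isOpen_lt continuous_const continuous_norm).mem_nhds (by simp [hv]; norm_num)
      filter_upwards [hmem] with u hu
      have : χ u = 0 := χ.zero_of_le_dist (by simpa [χ] using (le_of_lt hu))
      simp [this]
    · have h1 : (1 : ℂ) - v ≠ 0 := sub_ne_zero.2 (Ne.symm hv)
      refine χ.contDiffAt.mul (ContDiffAt.inv ?_ (by positivity))
      exact ((contDiffAt_const.sub contDiffAt_id).norm ℝ h1).pow n
  · have : χ v = 1 := χ.one_of_mem_closedBall (by simpa [χ] using hv)
    simp [this]

lemma summable_inv_norm_pow {n : ℕ} (hn : 2 < n) (z : ℂ) :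
    Summable fun w : Λ => (‖z - (w : ℂ)‖ ^ n)⁻¹ := by
  have := ZLattice.summable_norm_sub_inv_pow Λ n (by simpa using hn) z
  simpa [norm_sub_rev z] using this

lemma contDiffAt_inv_norm_sub_pow (n : ℕ) {w z : ℂ} (h : z ≠ w) :
    ContDiffAt ℝ ∞ (fun z => (‖z - w‖ ^ n)⁻¹) z := by
  have h1 : z - w ≠ 0 := sub_ne_zero.2 h
  exact (((contDiffAt_id.sub contDiffAt_const).norm ℝ h1).pow n).inv (by positivity)

/-- Multiplication by `w⁻¹` has norm at most `1`, so the `k`-th derivative of a term is bounded by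
`C k * ‖w‖^(-n)`. This is summable over a planar lattice for `n > 2`, and the series may be
differentiated termwise. -/
lemma contDiff_tsum_rescaled {n : ℕ} (hn : 2 < n) {G : ℂ → ℝ} (hG : ContDiff ℝ ∞ G)
    (hGc : HasCompactSupport G) (T : Set Λ) (hT : ∀ w ∈ T, 1 ≤ ‖(w : ℂ)‖) :
    ContDiff ℝ ∞ fun z =>
      ∑' w : Λ, T.indicator (fun w => (‖(w : ℂ)‖ ^ n)⁻¹ * G ((w : ℂ)⁻¹ * z)) w := by
  have hC : ∀ k : ℕ, ∃ C, ∀ v, ‖iteratedFDeriv ℝ k G v‖ ≤ C := fun k =>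
    (hGc.iteratedFDeriv k).exists_bound_of_continuous
      (hG.continuous_iteratedFDeriv (by exact_mod_cast le_top))
  choose C hC using hC
  have hcomp : ∀ w : ℂ, ContDiff ℝ ∞ (G ∘ ContinuousLinearMap.mul ℝ ℂ w) := fun w =>
    hG.comp (ContinuousLinearMap.contDiff (ContinuousLinearMap.mul ℝ ℂ w))
  refine contDiff_tsum (𝕜 := ℝ) (N := ⊤) (v := fun k (w : Λ) => C k * (‖(w : ℂ)‖ ^ n)⁻¹) (fun w => ?_)
    (fun k _ => ?_) (fun k w z hk => ?_)
  · by_cases hw : w ∈ T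
    · simp only [indicator_of_mem hw]
      exact (contDiff_const (c := (‖(w : ℂ)‖ ^ n)⁻¹)).mul (hcomp (w : ℂ)⁻¹)
    · simp only [indicator_of_notMem hw]
      exact contDiff_const
  · simpa using (summable_inv_norm_pow hn 0).mul_left (C k)
  · have hC0 : 0 ≤ C k := (norm_nonneg _).trans (hC k 0)
    by_cases hw : w ∈ T
    · simp only [indicator_of_mem hw]
      have h1 : (fun z => (‖(w : ℂ)‖ ^ n)⁻¹ * G ((w : ℂ)⁻¹ * z)) =
          (‖(w : ℂ)‖ ^ n)⁻¹ • (G ∘ ContinuousLinearMap.mul ℝ ℂ (w : ℂ)⁻¹) := rfl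
      have hk' : ((k : ℕ∞) : WithTop ℕ∞) ≤ ((⊤ : ℕ∞) : WithTop ℕ∞) := by exact_mod_cast hk
      rw [h1, iteratedFDeriv_const_smul_apply (((hcomp _).of_le hk').contDiffAt),
        norm_smul, ContinuousLinearMap.iteratedFDeriv_comp_right _ hG _ hk',
        norm_inv, norm_pow, norm_norm, mul_comm]
      gcongr
      refine (ContinuousMultilinearMap.norm_compContinuousLinearMap_le _ _).trans ?_
      have h2 : ∏ _i : Fin k, ‖ContinuousLinearMap.mul ℝ ℂ (w : ℂ)⁻¹‖ ≤ 1 := by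
        refine Finset.prod_le_one (fun _ _ => norm_nonneg _) fun _ _ => ?_
        refine (ContinuousLinearMap.opNorm_mul_apply_le ℝ ℂ _).trans ?_
        rw [norm_inv]
        exact inv_le_one_of_one_le₀ (hT w hw)
      calc _ ≤ C k * 1 := mul_le_mul (hC k _) h2
            (Finset.prod_nonneg fun _ _ => norm_nonneg _) hC0
        _ = C k := mul_one _
    · simp only [indicator_of_notMem hw]
      have : iteratedFDeriv ℝ k (fun _ : ℂ => (0 : ℝ)) z = 0 := by
        simp
      rw [this, norm_zero]
      positivity

lemma finite_lattice_norm_lt (R : ℝ) : {w : Λ | ‖(w : ℂ)‖ < R}.Finite := by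
  refine Finite.subset (isCompact_closedBall (0 : Λ) R).finite_of_discrete fun w hw => ?_
  simpa using (le_of_lt hw)

/-- A lattice sum of inverse powers of the distance is smooth off the points of the lattice over
which one sums. -/
lemma contDiffAt_tsum_inv_norm_pow {n : ℕ} (hn : 2 < n) (T : Set Λ) {z₀ : ℂ}
    (hz₀ : ∀ w ∈ T, z₀ ≠ (w : ℂ)) :
    ContDiffAt ℝ ∞
      (fun z => ∑' w : Λ, T.indicator (fun w => (‖z - (w : ℂ)‖ ^ n)⁻¹) w) z₀ := by
  obtain ⟨G, hG, hGc, hGeq⟩ := exists_contDiff_eq_inv_norm_pow n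
  -- For `z` in the unit ball about `z₀` and `‖w‖ ≥ R`, this ensures `‖w⁻¹ z‖ ≤ 1 / 2`, where `G` is
  -- the true term. Only finitely many `w` remain.
  set R : ℝ := 2 * (‖z₀‖ + 1) with hR
  have hR2 : 2 ≤ R := by linarith [norm_nonneg z₀]
  set F : Set Λ := {w : Λ | ‖(w : ℂ)‖ < R} with hF
  have hFfin : F.Finite := finite_lattice_norm_lt R
  have htail := contDiff_tsum_rescaled hn hG hGc (T \ F) fun w hw => by
    have : R ≤ ‖(w : ℂ)‖ := not_lt.1 hw.2
    linarith
  have hfin : ContDiffAt ℝ ∞ (fun z => ∑ w ∈ hFfin.toFinset,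
      T.indicator (fun w : Λ => (‖z - (w : ℂ)‖ ^ n)⁻¹) w) z₀ := by
    refine ContDiffAt.sum fun w _ => ?_
    by_cases hw : w ∈ T
    · simp only [indicator_of_mem hw]
      exact contDiffAt_inv_norm_sub_pow n (hz₀ w hw)
    · simp only [indicator_of_notMem hw]
      exact contDiffAt_const
  refine (hfin.add htail.contDiffAt).congr_of_eventuallyEq ?_
  filter_upwards [Metric.ball_mem_nhds z₀ one_pos] with z hz
  have hz1 : ‖z‖ ≤ ‖z₀‖ + 1 := by
    have h1 := mem_ball_iff_norm.1 hz
    have h2 := norm_sub_norm_le z z₀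
    linarith
  have hsum := summable_inv_norm_pow hn z
  rw [← (hsum.indicator T).sum_add_tsum_compl (s := hFfin.toFinset), tsum_subtype]
  congr 1
  refine tsum_congr fun w => ?_
  by_cases hwF : w ∈ F
  · simp [hwF]
  by_cases hwT : w ∈ T
  · have hw : w ∈ T \ F := ⟨hwT, hwF⟩
    have hwR : R ≤ ‖(w : ℂ)‖ := not_lt.1 hwF
    have hw0 : (w : ℂ) ≠ 0 := norm_pos_iff.1 (by linarith)
    rw [indicator_of_mem (by simpa using hwF), indicator_of_mem hwT, indicator_of_mem hw, hGeq,
      ← mul_inv, ← mul_pow, ← norm_mul, mul_sub, mul_one, mul_inv_cancel_left₀ hw0,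
      norm_sub_rev]
    rw [norm_mul, norm_inv, inv_mul_le_iff₀ (by positivity)]
    linarith
  · simp [hwT]

/-! ### The functions `Psi` -/

lemma norm_zpow_eq {r : ℕ} (hr : 1 ≤ r) (x : ℂ) :
    ‖x‖ ^ (-(4 * (r : ℤ) - 4)) = (‖x‖ ^ (4 * r - 4))⁻¹ := by
  have : 4 * (r : ℤ) - 4 = ((4 * r - 4 : ℕ) : ℤ) := by omega
  rw [zpow_neg, this, zpow_natCast]

lemma Psi_eq_sqrt {r : ℕ} (hr : 1 ≤ r) (c z : ℂ) :
    Psi r c z = Real.sqrt (∑' w : Λ, (‖z - c - (w : ℂ)‖ ^ (4 * r - 4))⁻¹) := by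
  simp only [Psi, norm_zpow_eq hr]

lemma Psi_add_lattice (r : ℕ) (c z : ℂ) {w₀ : ℂ} (hw₀ : w₀ ∈ Λ) :
    Psi r (c + w₀) z = Psi r c z := by
  unfold Psi
  congr 1
  rw [← (Equiv.subRight (⟨w₀, hw₀⟩ : Λ)).tsum_eq (fun w : Λ => ‖z - (c + w₀) - (w : ℂ)‖ ^ _)]
  refine tsum_congr fun w => ?_
  have : z - (c + w₀) - ((w : ℂ) - w₀) = z - c - (w : ℂ) := by ring
  simp [this]

lemma Psi_add_lattice_right (r : ℕ) (c z : ℂ) {w₀ : ℂ} (hw₀ : w₀ ∈ Λ) :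
    Psi r c (z + w₀) = Psi r c z := by
  have h : Psi r c (z + w₀) = Psi r (c + -w₀) z := by
    unfold Psi
    simp only [← sub_sub, sub_neg_eq_add, sub_add_eq_add_sub]
  rw [h, Psi_add_lattice r c z (neg_mem hw₀)]

lemma tsum_inv_norm_pow_pos {n : ℕ} (hn : 2 < n) {z : ℂ} (hz : z ∉ Λ) :
    0 < ∑' w : Λ, (‖z - (w : ℂ)‖ ^ n)⁻¹ := by
  have h0 : z ≠ 0 := fun h => hz (h ▸ zero_mem _)
  refine (summable_inv_norm_pow hn z).tsum_pos (fun w => by positivity) 0 ?_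
  have : 0 < ‖z‖ := norm_pos_iff.2 h0
  simpa using by positivity

lemma Psi_pos {r : ℕ} (hr : 2 ≤ r) {c z : ℂ} (hz : z - c ∉ Λ) : 0 < Psi r c z := by
  rw [Psi_eq_sqrt (by omega)]
  exact Real.sqrt_pos.2 (tsum_inv_norm_pow_pos (by omega) hz)

lemma contDiffAt_Psi {r : ℕ} (hr : 2 ≤ r) {c z : ℂ} (hz : z - c ∉ Λ) :
    ContDiffAt ℝ ∞ (Psi r c) z := by
  have h1 : ContDiffAt ℝ ∞
      (fun z => ∑' w : Λ, univ.indicator (fun w => (‖z - (w : ℂ)‖ ^ (4 * r - 4))⁻¹) w) (z - c) :=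
    contDiffAt_tsum_inv_norm_pow (by omega) univ fun w _ h => hz (h ▸ w.2)
  simp only [indicator_univ] at h1
  have h2 := h1.comp z (contDiffAt_id.sub (contDiffAt_const (c := c)))
  have h3 := h2.sqrt (tsum_inv_norm_pow_pos (by omega) hz).ne'
  have h4 : Psi r c = fun z => Real.sqrt (∑' w : Λ, (‖z - c - (w : ℂ)‖ ^ (4 * r - 4))⁻¹) :=
    funext fun z => Psi_eq_sqrt (by omega) c z
  rw [h4]
  exact h3

/-- At its own singularity `c`, the function `Psi` is `|z - c|^{-(2r - 2)}` times a smooth one. -/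
lemma exists_contDiffAt_Psi_self {r : ℕ} (hr : 2 ≤ r) (c : ℂ) :
    ∃ Q : ℂ → ℝ, ContDiffAt ℝ ∞ Q c ∧ Q c = 1 ∧
      ∀ z, z ≠ c → ‖z - c‖ ^ (2 * r - 2) * Psi r c z = Q z := by
  set S : ℂ → ℝ := fun z => ∑' w : Λ,
    ({0}ᶜ : Set Λ).indicator (fun w => (‖z - (w : ℂ)‖ ^ (4 * r - 4))⁻¹) w with hS
  have hS0 : ContDiffAt ℝ ∞ S (c - c) := by
    rw [sub_self]
    exact contDiffAt_tsum_inv_norm_pow (by omega) _ fun w hw h => hw (by ext; exact h.symm)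
  have hn : ContDiffAt ℝ ∞ (fun z : ℂ => (‖z - c‖ ^ 2) ^ (2 * r - 2)) c :=
    ((contDiffAt_id.sub contDiffAt_const).norm_sq ℝ).pow _
  have hr0 : 2 * r - 2 ≠ 0 := by omega
  -- Obtained from `Psi ^ 2 = ‖z - c‖^(-(4r-4)) + S (z - c)` by multiplying with `‖z - c‖^(4r-4)`.
  -- The latter is written as a power of the squared norm, which is smooth at `c` too.
  refine ⟨fun z => Real.sqrt (1 + (‖z - c‖ ^ 2) ^ (2 * r - 2) * S (z - c)), ?_, ?_, fun z hz => ?_⟩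
  · refine ContDiffAt.sqrt (contDiffAt_const.add (hn.mul ?_)) ?_
    · exact ContDiffAt.comp (f := fun z => z - c) c hS0 (contDiffAt_id.sub contDiffAt_const)
    · simp [hr0]
  · simp [hr0]
  · have hpos : 0 < ‖z - c‖ := norm_pos_iff.2 (sub_ne_zero.2 hz)
    have hsum := summable_inv_norm_pow (n := 4 * r - 4) (by omega) (z - c)
    have hsplit : ∑' w : Λ, (‖z - c - (w : ℂ)‖ ^ (4 * r - 4))⁻¹ =
        (‖z - c‖ ^ (4 * r - 4))⁻¹ + S (z - c) := by
      rw [← hsum.sum_add_tsum_compl (s := {0}), Finset.coe_singleton,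
        tsum_subtype ({0}ᶜ : Set Λ) fun w : Λ => (‖z - c - (w : ℂ)‖ ^ (4 * r - 4))⁻¹]
      simp [hS]
    have hexp : ‖z - c‖ ^ (4 * r - 4) = (‖z - c‖ ^ 2) ^ (2 * r - 2) := by
      rw [← pow_mul]
      congr 1
      omega
    rw [Psi_eq_sqrt (by omega), hsplit, hexp]
    have h1 : ‖z - c‖ ^ (2 * r - 2) = Real.sqrt ((‖z - c‖ ^ 2) ^ (2 * r - 2)) := by
      rw [pow_right_comm, Real.sqrt_sq (by positivity)]
    rw [h1, ← Real.sqrt_mul (by positivity), mul_add, mul_inv_cancel₀ (by positivity)]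

/-! ### Lattice translates and periodic fields -/

/-- The zeros and poles of a nuclear elliptic function. -/
def singularSet (a b : ℂ) : Set ℂ := {z | z - a ∈ Λ ∨ z - b ∈ Λ}

lemma isClosed_setOf_sub_mem_lattice (c : ℂ) : IsClosed {z : ℂ | z - c ∈ Λ} :=
  gaussPeriods.isClosed_lattice.preimage (continuous_id.sub continuous_const)

lemma isClosed_singularSet (a b : ℂ) : IsClosed (singularSet a b) :=
  (isClosed_setOf_sub_mem_lattice a).union (isClosed_setOf_sub_mem_lattice b)

lemma eventually_sub_notMem_lattice {c z : ℂ} (h : z - c ∉ Λ) : ∀ᶠ u in 𝓝 z, u - c ∉ Λ :=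
  (isClosed_setOf_sub_mem_lattice c).isOpen_compl.mem_nhds h

lemma eventually_ne_sub_notMem_lattice (c z : ℂ) : ∀ᶠ u in 𝓝[≠] z, u - c ∉ Λ := by
  have h : Tendsto (fun u => u - c) (𝓝 z) (𝓝 (z - c)) :=
    (continuous_id.sub continuous_const).tendsto z
  rw [eventually_nhdsWithin_iff]
  filter_upwards [h (gaussPeriods.compl_lattice_sdiff_singleton_mem_nhds (z - c))] with u hu huz hmem
  exact hu ⟨hmem, fun h => huz (sub_left_injective h)⟩

lemma exists_lattice_norm_sub_le (z : ℂ) : ∃ w ∈ Λ, ‖z - w‖ ≤ 2 := by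
  refine ⟨⌊z.re⌋ * 1 + ⌊z.im⌋ * Complex.I, PeriodPair.mem_lattice.2 ⟨⌊z.re⌋, ⌊z.im⌋, rfl⟩, ?_⟩
  refine (Complex.norm_le_abs_re_add_abs_im _).trans ?_
  have h1 : (z - (⌊z.re⌋ * 1 + ⌊z.im⌋ * Complex.I)).re = Int.fract z.re := by
    simp [Int.self_sub_floor]
  have h2 : (z - (⌊z.re⌋ * 1 + ⌊z.im⌋ * Complex.I)).im = Int.fract z.im := by
    simp [Int.self_sub_floor]
  rw [h1, h2, abs_of_nonneg (Int.fract_nonneg _), abs_of_nonneg (Int.fract_nonneg _)]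
  linarith [Int.fract_lt_one z.re, Int.fract_lt_one z.im]

lemma exists_bound_of_periodic {F : Type*} [NormedAddCommGroup F] {u : ℂ → F}
    (hu : Continuous u) (hper : ∀ w ∈ Λ, ∀ z, u (z + w) = u z) :
    ∃ M : NNReal, ∀ z, ‖u z‖ ≤ M := by
  obtain ⟨M, hM⟩ := (isCompact_closedBall (0 : ℂ) 2).exists_bound_of_continuousOn hu.continuousOn
  refine ⟨M.toNNReal, fun z => ?_⟩
  obtain ⟨w, hw, hzw⟩ := exists_lattice_norm_sub_le z
  have h := hper w hw (z - w)
  rw [sub_add_cancel] at h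
  rw [h]
  exact (hM _ (by simpa using hzw)).trans (Real.le_coe_toNNReal M)

/-- Every point is a lattice translate of one in a fixed compact disc, so the field and its
derivative, both periodic and continuous, are bounded; a bounded derivative gives a global Lipschitz
constant. -/
lemma lipschitzBounded_of_periodic {X : ℂ → ℂ} (hX : ContDiff ℝ ∞ X)
    (hper : ∀ w ∈ Λ, ∀ z, X (z + w) = X z) : LipschitzBounded X := by
  refine ⟨?_, exists_bound_of_periodic hX.continuous hper⟩
  have h1 : (∞ : WithTop ℕ∞) ≠ 0 := by simp
  obtain ⟨K, hK⟩ := exists_bound_of_periodic (u := fderiv ℝ X) (hX.continuous_fderiv h1)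
    fun w hw z => by
      have h : (fun z => X (z + w)) = X := funext (hper w hw)
      rw [← fderiv_comp_add_right, h]
  exact ⟨K, lipschitzWith_of_nnnorm_fderiv_le (hX.differentiable h1) fun z => by
    exact_mod_cast hK z⟩

/-! ### Local structure of the two fields -/

section Nuclear

variable {f : ℂ → ℂ} {r : ℕ} {a b : ℂ}

lemma IsNuclear.order_add (hf : IsNuclear f r a b) {w : ℂ} (hw : w ∈ Λ) (z : ℂ) :
    meromorphicOrderAt f (z + w) = meromorphicOrderAt f z := by
  rw [← meromorphicOrderAt_comp_add_const_eq_meromorphicOrderAt]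
  congr 1
  exact funext (hf.periodic w hw)

lemma IsNuclear.order_of_sub_zero_mem (hf : IsNuclear f r a b) {z : ℂ} (hz : z - a ∈ Λ) :
    meromorphicOrderAt f z = ((r : ℤ) : WithTop ℤ) := by
  rw [← hf.order_zero, ← hf.order_add hz a, add_sub_cancel]

lemma IsNuclear.order_of_sub_pole_mem (hf : IsNuclear f r a b) {z : ℂ} (hz : z - b ∈ Λ) :
    meromorphicOrderAt f z = ((-(r : ℤ) : ℤ) : WithTop ℤ) := by
  rw [← hf.order_pole, ← hf.order_add hz b, add_sub_cancel]

lemma IsNuclear.sub_pole_notMem (hf : IsNuclear f r a b) (hr : 2 ≤ r) {z : ℂ}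
    (hz : z - a ∈ Λ) : z - b ∉ Λ := fun hb => by
  have h := (hf.order_of_sub_zero_mem hz).symm.trans (hf.order_of_sub_pole_mem hb)
  have : (r : ℤ) = -(r : ℤ) := by exact_mod_cast h
  omega

lemma IsNuclear.order_neg_iff (hf : IsNuclear f r a b) (hr : 2 ≤ r) (z : ℂ) :
    meromorphicOrderAt f z < 0 ↔ z - b ∈ Λ := by
  constructor
  · intro h
    by_contra hb
    by_cases ha : z - a ∈ Λ
    · rw [hf.order_of_sub_zero_mem ha] at h
      have : ((r : ℤ)) < 0 := by exact_mod_cast h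
      omega
    · rw [hf.order_other z ha hb] at h
      exact lt_irrefl _ h
  · intro h
    rw [hf.order_of_sub_pole_mem h]
    have : -(r : ℤ) < 0 := by omega
    exact_mod_cast this

lemma IsNuclear.analyticAt (hf : IsNuclear f r a b) (hr : 2 ≤ r) {z : ℂ} (hz : z - b ∉ Λ) :
    AnalyticAt ℂ f z :=
  hf.analytic z (not_lt.1 fun h => hz ((hf.order_neg_iff hr z).1 h))

lemma IsNuclear.ne_zero (hf : IsNuclear f r a b) (hr : 2 ≤ r) {z : ℂ} (ha : z - a ∉ Λ)
    (hb : z - b ∉ Λ) : f z ≠ 0 := by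
  have h := hf.analyticAt hr hb
  have h0 := hf.order_other z ha hb
  rw [h.meromorphicOrderAt_eq] at h0
  rw [← h.analyticOrderAt_eq_zero]
  cases hn : analyticOrderAt f z with
  | top => simp [hn] at h0
  | coe n =>
    rw [hn, ENat.map_natCast] at h0
    have : (n : ℤ) = 0 := by exact_mod_cast h0
    simpa using this

/-- With `rescaled_translate_zero`, this reduces the local analysis at any zero to the base point
`a`. -/
lemma IsNuclear.translate_zero (hf : IsNuclear f r a b) {p : ℂ} (hp : p - a ∈ Λ) :
    IsNuclear f r p b where
  meromorphic := hf.meromorphic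
  analytic := hf.analytic
  periodic := hf.periodic
  order_zero := hf.order_of_sub_zero_mem hp
  order_pole := hf.order_pole
  order_other z hz hb := hf.order_other z
    (fun h => hz (by simpa using sub_mem h hp)) hb

lemma rescaled_translate_zero {p : ℂ} (hp : p - a ∈ Λ) : rescaled f r p b = rescaled f r a b := by
  funext z
  have h1 : z - p ∈ Λ ↔ z - a ∈ Λ := by
    have : z - a = (z - p) + (p - a) := by ring
    rw [this]
    exact ⟨fun h => add_mem h hp, fun h => by simpa using sub_mem h hp⟩
  have h2 : Psi r p z = Psi r a z := by
    rw [← Psi_add_lattice r a z hp, add_sub_cancel]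
  classical
  unfold rescaled
  exact if_congr (or_congr_left h1) rfl (by rw [h2])

lemma rescaled_of_mem {z : ℂ} (h : z ∈ singularSet a b) : rescaled f r a b z = 0 :=
  if_pos h

lemma rescaled_of_notMem {z : ℂ} (h : z ∉ singularSet a b) :
    rescaled f r a b z = ((Psi r a z * Psi r b z : ℝ) : ℂ) * desingularized f z :=
  if_neg h

/-! ### Zeros -/

lemma IsNuclear.desingularized_eventuallyEq (hf : IsNuclear f r a b) (hr : 2 ≤ r) {z : ℂ}
    (hz : z - b ∉ Λ) : desingularized f =ᶠ[𝓝 z] fun z =>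
      -((((1 + ‖f z‖ ^ 4)⁻¹ : ℝ) : ℂ) * (starRingEnd ℂ) (deriv f z) * f z) := by
  filter_upwards [eventually_sub_notMem_lattice hz] with u hu
  rw [desingularized, if_neg fun h => hu ((hf.order_neg_iff hr u).1 h)]

lemma contDiffAt_ofReal {u : ℂ → ℝ} {z : ℂ} (hu : ContDiffAt ℝ ∞ u z) :
    ContDiffAt ℝ ∞ (fun z => (u z : ℂ)) z :=
  (ContinuousLinearMap.contDiff Complex.ofRealCLM).contDiffAt.comp z hu

lemma contDiffAt_conj {u : ℂ → ℂ} {z : ℂ} (hu : ContDiffAt ℝ ∞ u z) :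
    ContDiffAt ℝ ∞ (fun z => (starRingEnd ℂ) (u z)) z :=
  (ContinuousLinearEquiv.contDiff Complex.conjCLE).contDiffAt.comp z hu

lemma contDiffAt_real_of_analyticAt {u : ℂ → ℂ} {z : ℂ} (hu : AnalyticAt ℂ u z) :
    ContDiffAt ℝ ∞ u z :=
  hu.contDiffAt.restrict_scalars ℝ

lemma contDiffAt_inv_one_add_norm_pow {u : ℂ → ℂ} {z : ℂ} (hu : ContDiffAt ℝ ∞ u z) :
    ContDiffAt ℝ ∞ (fun z => (1 + ‖u z‖ ^ 4)⁻¹) z := by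
  -- The squared norm is smooth also where `u` vanishes, unlike the norm.
  have h1 : ∀ z, ‖u z‖ ^ 4 = (‖u z‖ ^ 2) ^ 2 := fun z => by ring
  simp only [h1]
  exact (contDiffAt_const.add ((hu.norm_sq ℝ).pow 2)).inv (by positivity)

lemma IsNuclear.contDiffAt_desingularized (hf : IsNuclear f r a b) (hr : 2 ≤ r) {z : ℂ}
    (hz : z - b ∉ Λ) : ContDiffAt ℝ ∞ (desingularized f) z := by
  have h := hf.analyticAt hr hz
  have h1 := contDiffAt_real_of_analyticAt h
  refine ContDiffAt.congr_of_eventuallyEq ?_ (hf.desingularized_eventuallyEq hr hz)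
  exact (((contDiffAt_ofReal (contDiffAt_inv_one_add_norm_pow h1)).mul
    (contDiffAt_conj (contDiffAt_real_of_analyticAt h.deriv))).mul h1).neg

lemma IsNuclear.exists_factorization (hf : IsNuclear f r a b) (hr : 2 ≤ r) :
    ∃ g k : ℂ → ℂ, AnalyticAt ℂ g a ∧ AnalyticAt ℂ k a ∧ g a ≠ 0 ∧ k a = r * g a ∧
      (∀ᶠ z in 𝓝 a, f z = (z - a) ^ r * g z) ∧
      ∀ᶠ z in 𝓝 a, deriv f z = (z - a) ^ (r - 1) * k z := by
  have haa : a - a ∈ Λ := by simp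
  have h := hf.analyticAt hr (hf.sub_pole_notMem hr haa)
  have h0 := hf.order_zero
  have hord : analyticOrderAt f a = r := by
    rw [h.meromorphicOrderAt_eq] at h0
    cases hn : analyticOrderAt f a with
    | top => simp [hn] at h0
    | coe n =>
      rw [hn, ENat.map_natCast] at h0
      have : (n : ℤ) = r := by exact_mod_cast h0
      exact_mod_cast this
  obtain ⟨g, hg, hga, hfg⟩ := h.analyticOrderAt_eq_natCast.1 hord
  refine ⟨g, fun z => r * g z + (z - a) * deriv g z, hg, ?_, hga, by simp, hfg, ?_⟩
  · exact (analyticAt_const.mul hg).add ((analyticAt_id.sub analyticAt_const).mul hg.deriv)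
  · filter_upwards [hfg.eventually_nhds, hg.eventually_analyticAt] with z hz hgz
    have hd : HasDerivAt (fun z => (z - a) ^ r • g z)
        (r * (z - a) ^ (r - 1) * 1 * g z + (z - a) ^ r * deriv g z) z :=
      (((hasDerivAt_id z).sub_const a).pow r).mul hgz.differentiableAt.hasDerivAt
    rw [EventuallyEq.deriv_eq hz, hd.deriv]
    obtain ⟨m, rfl⟩ : ∃ m, r = m + 1 := ⟨r - 1, by omega⟩
    simp only [Nat.add_sub_cancel]
    ring

/-- At the zero `a` the rescaled field is `z - a` times a smooth function with a negative value at
`a`. -/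
lemma IsNuclear.exists_rescaled_eventuallyEq (hf : IsNuclear f r a b) (hr : 2 ≤ r) :
    ∃ (H : ℂ → ℂ) (c : ℝ), 0 < c ∧ ContDiffAt ℝ ∞ H a ∧ H a = -c ∧
      rescaled f r a b =ᶠ[𝓝 a] fun z => (z - a) * H z := by
  have haa : a - a ∈ Λ := by simp
  have hab : a - b ∉ Λ := hf.sub_pole_notMem hr haa
  have h := hf.analyticAt hr hab
  obtain ⟨g, k, hg, hk, hga, hka, hfg, hfk⟩ := hf.exists_factorization hr
  obtain ⟨Q, hQ, hQa, hPsi⟩ := exists_contDiffAt_Psi_self hr a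
  have hfa : f a = 0 := by
    rw [hfg.self_of_nhds, sub_self, zero_pow (by omega), zero_mul]
  have hpsib := Psi_pos hr hab
  -- The field with `‖z - a‖^(2r-2)` moved from `conj f' * f` into `Psi r a`, which turns the latter
  -- into `Q`. At `a` one has `Q = 1`, `f = 0` and `k = r g`, whence the constant.
  refine ⟨fun z => ((Q z * Psi r b z : ℝ) : ℂ) * -((((1 + ‖f z‖ ^ 4)⁻¹ : ℝ) : ℂ) *
    (starRingEnd ℂ) (k z) * g z), Psi r b a * (r * ‖g a‖ ^ 2), ?_, ?_, ?_, ?_⟩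
  · have : 0 < ‖g a‖ := norm_pos_iff.2 hga
    have : (0 : ℝ) < r := by exact_mod_cast (by omega : 0 < r)
    positivity
  · exact (contDiffAt_ofReal (hQ.mul (contDiffAt_Psi hr hab))).mul
      (((contDiffAt_ofReal (contDiffAt_inv_one_add_norm_pow (contDiffAt_real_of_analyticAt h))).mul
      (contDiffAt_conj (contDiffAt_real_of_analyticAt hk))).mul
      (contDiffAt_real_of_analyticAt hg)).neg
  · have h1 : (starRingEnd ℂ) (g a) * g a = ((‖g a‖ ^ 2 : ℝ) : ℂ) := by
      rw [Complex.conj_mul']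
      push_cast
      rfl
    simp only [hQa, hfa, hka, map_mul, Complex.conj_natCast, mul_assoc, h1]
    push_cast
    simp
  · have hne := eventually_nhdsWithin_iff.1 (eventually_ne_sub_notMem_lattice a a)
    filter_upwards [hfg, hfk, hne, eventually_sub_notMem_lattice hab,
      (hf.desingularized_eventuallyEq hr hab)] with z h1 h2 h3 h4 h5
    by_cases hza : z = a
    · subst hza
      rw [rescaled, if_pos (Or.inl haa)]
      simp
    · rw [rescaled, if_neg (not_or.2 ⟨h3 hza, h4⟩), h5, ← hPsi z hza]
      -- `conj (z - a)^(r-1)` from `f'` pairs with `r - 1` of the `r` factors `z - a` of `f`.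
      have h6 : (starRingEnd ℂ) (deriv f z) * f z =
          ((‖z - a‖ ^ (2 * r - 2) : ℝ) : ℂ) * ((z - a) * ((starRingEnd ℂ) (k z) * g z)) := by
        obtain ⟨m, rfl⟩ : ∃ m, r = m + 1 := ⟨r - 1, by omega⟩
        have h7 : 2 * (m + 1) - 2 = 2 * m := by omega
        rw [h1, h2, h7, pow_mul]
        push_cast
        rw [← Complex.conj_mul']
        simp only [map_mul, map_pow, mul_pow]
        ring
      rw [mul_assoc (((1 + ‖f z‖ ^ 4)⁻¹ : ℝ) : ℂ), h6]
      push_cast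
      ring

lemma IsNuclear.hasFDerivAt_rescaled_self (hf : IsNuclear f r a b) (hr : 2 ≤ r) :
    ∃ c : ℝ, 0 < c ∧
      HasFDerivAt (rescaled f r a b) (-c • ContinuousLinearMap.id ℝ ℂ) a := by
  obtain ⟨H, c, hc, hH, hHa, hX⟩ := hf.exists_rescaled_eventuallyEq hr
  refine ⟨c, hc, HasFDerivAt.congr_of_eventuallyEq ?_ hX⟩
  have hHd := (hH.differentiableAt (by simp)).hasFDerivAt
  refine (((hasFDerivAt_id a).sub_const a).mul hHd).congr_fderiv ?_
  ext v
  simp [hHa]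

lemma IsNuclear.contDiffAt_rescaled_self (hf : IsNuclear f r a b) (hr : 2 ≤ r) :
    ContDiffAt ℝ ∞ (rescaled f r a b) a := by
  obtain ⟨H, c, hc, hH, hHa, hX⟩ := hf.exists_rescaled_eventuallyEq hr
  exact ((contDiffAt_id.sub contDiffAt_const).mul hH).congr_of_eventuallyEq hX

lemma IsNuclear.contDiffAt_rescaled (hf : IsNuclear f r a b) (hr : 2 ≤ r) {z : ℂ}
    (hb : z - b ∉ Λ) : ContDiffAt ℝ ∞ (rescaled f r a b) z := by
  by_cases ha : z - a ∈ Λ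
  · rw [← rescaled_translate_zero ha]
    exact (hf.translate_zero ha).contDiffAt_rescaled_self hr
  · refine ContDiffAt.congr_of_eventuallyEq (f := fun z => ((Psi r a z * Psi r b z : ℝ) : ℂ) *
      desingularized f z) ?_ ?_
    · exact (contDiffAt_ofReal ((contDiffAt_Psi hr ha).mul (contDiffAt_Psi hr hb))).mul
        (hf.contDiffAt_desingularized hr hb)
    · filter_upwards [eventually_sub_notMem_lattice ha, eventually_sub_notMem_lattice hb]
        with u hua hub
      rw [rescaled, if_neg (not_or.2 ⟨hua, hub⟩)]

lemma IsNuclear.eq_zero (hf : IsNuclear f r a b) (hr : 2 ≤ r) {z : ℂ} (hz : z - a ∈ Λ) :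
    f z = 0 := by
  obtain ⟨g, k, -, -, -, -, hfg, -⟩ := (hf.translate_zero hz).exists_factorization hr
  rw [hfg.self_of_nhds, sub_self, zero_pow (by omega), zero_mul]

/-! ### The reciprocalFun function -/

open Classical in
/-- The reciprocal `1 / f`, continued by `0` into the poles of `f`. -/
noncomputable def reciprocalFun (f : ℂ → ℂ) (z : ℂ) : ℂ :=
  if meromorphicOrderAt f z < 0 then 0 else (f z)⁻¹

lemma IsNuclear.reciprocal_eventuallyEq (hf : IsNuclear f r a b) (hr : 2 ≤ r) {z : ℂ}
    (hz : z - b ∉ Λ) : reciprocalFun f =ᶠ[𝓝 z] f⁻¹ := by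
  filter_upwards [eventually_sub_notMem_lattice hz] with u hu
  rw [reciprocalFun, if_neg fun h => hu ((hf.order_neg_iff hr u).1 h), Pi.inv_apply]

lemma IsNuclear.reciprocal_eventuallyEq_ne (hf : IsNuclear f r a b) (hr : 2 ≤ r) (z : ℂ) :
    reciprocalFun f =ᶠ[𝓝[≠] z] f⁻¹ := by
  filter_upwards [eventually_ne_sub_notMem_lattice b z] with u hu
  rw [reciprocalFun, if_neg fun h => hu ((hf.order_neg_iff hr u).1 h), Pi.inv_apply]

lemma IsNuclear.order_reciprocal (hf : IsNuclear f r a b) (hr : 2 ≤ r) (z : ℂ) :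
    meromorphicOrderAt (reciprocalFun f) z = -meromorphicOrderAt f z := by
  rw [meromorphicOrderAt_congr (hf.reciprocal_eventuallyEq_ne hr z), meromorphicOrderAt_inv]

/-- At the poles of `f` the pointwise inverse `f⁻¹` would carry an arbitrary value; the prescribed
value `0` makes the reciprocal analytic there. -/
lemma IsNuclear.reciprocal (hf : IsNuclear f r a b) (hr : 2 ≤ r) :
    IsNuclear (reciprocalFun f) r b a where
  meromorphic z := ((hf.meromorphic z).inv).congr (hf.reciprocal_eventuallyEq_ne hr z).symm
  analytic z hz := by
    rw [hf.order_reciprocal hr] at hz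
    by_cases hb : z - b ∈ Λ
    · refine AnalyticAt.of_meromorphicOrderAt_pos ?_ ?_
      · rw [hf.order_reciprocal hr, hf.order_of_sub_pole_mem hb]
        have : 0 < - -(r : ℤ) := by omega
        exact_mod_cast this
      · rw [reciprocalFun, if_pos ((hf.order_neg_iff hr z).2 hb)]
    · have ha : z - a ∉ Λ := fun ha => by
        rw [hf.order_of_sub_zero_mem ha] at hz
        have : 0 ≤ -(r : ℤ) := by exact_mod_cast hz
        omega
      exact ((hf.analyticAt hr hb).inv (hf.ne_zero hr ha hb)).congr
        (hf.reciprocal_eventuallyEq hr hb).symm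
  periodic w hw z := by
    simp only [reciprocalFun, hf.order_add hw, hf.periodic w hw]
  order_zero := by
    rw [hf.order_reciprocal hr, hf.order_pole]
    exact_mod_cast neg_neg (r : ℤ)
  order_pole := by
    rw [hf.order_reciprocal hr, hf.order_zero]
    rfl
  order_other z hb ha := by
    rw [hf.order_reciprocal hr, hf.order_other z ha hb]
    rfl

lemma IsNuclear.desingularized_eq_zero (hf : IsNuclear f r a b) (hr : 2 ≤ r) {z : ℂ}
    (hz : z ∈ singularSet a b) : desingularized f z = 0 := by
  rcases hz with h | h
  · rw [desingularized, hf.eq_zero hr h]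
    simp
  · rw [desingularized, if_pos ((hf.order_neg_iff hr z).2 h)]

lemma singularSet_comm (a b : ℂ) : singularSet a b = singularSet b a :=
  Set.ext fun _ => or_comm

/-- Since `(1/f)' = -f' / f²`, the product `conj (1/f)' * (1/f)` is `-conj f' * f / |f|⁴`, and the
factor `(1 + |f|⁻⁴)⁻¹` compensates the `|f|⁴`. -/
lemma IsNuclear.desingularized_reciprocal (hf : IsNuclear f r a b) (hr : 2 ≤ r) (z : ℂ) :
    desingularized (reciprocalFun f) z = -desingularized f z := by
  by_cases hz : z ∈ singularSet a b
  · rw [hf.desingularized_eq_zero hr hz,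
      (hf.reciprocal hr).desingularized_eq_zero hr (singularSet_comm a b ▸ hz), neg_zero]
  obtain ⟨ha, hb⟩ := not_or.1 hz
  have hfz := hf.ne_zero hr ha hb
  have hfz' : (starRingEnd ℂ) (f z) ≠ 0 := by simpa using hfz
  have hd : deriv (reciprocalFun f) z = -deriv f z / f z ^ 2 := by
    rw [(hf.reciprocal_eventuallyEq hr hb).deriv_eq]
    exact ((hf.analyticAt hr hb).differentiableAt.hasDerivAt.inv hfz).deriv
  rw [((hf.reciprocal hr).desingularized_eventuallyEq hr ha).self_of_nhds,
    (hf.desingularized_eventuallyEq hr hb).self_of_nhds]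
  dsimp only
  rw [hd, (hf.reciprocal_eventuallyEq hr hb).self_of_nhds, Pi.inv_apply]
  have h4 : ((‖f z‖ : ℝ) : ℂ) ^ 4 = ((starRingEnd ℂ) (f z) * f z) ^ 2 := by
    rw [Complex.conj_mul']
    ring
  have hpos : (1 : ℂ) + ((starRingEnd ℂ) (f z) * f z) ^ 2 ≠ 0 := by
    rw [← h4]
    have : (0 : ℝ) < 1 + ‖f z‖ ^ 4 := by positivity
    exact_mod_cast this.ne'
  simp only [norm_inv, map_div₀, map_neg, map_pow]
  push_cast
  rw [inv_pow, h4]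
  have hpos' : (1 : ℂ) + (((starRingEnd ℂ) (f z) * f z) ^ 2)⁻¹ ≠ 0 := by
    intro h
    apply hpos
    field_simp at h
    linear_combination h
  field_simp
  ring

lemma IsNuclear.rescaled_reciprocal (hf : IsNuclear f r a b) (hr : 2 ≤ r) (z : ℂ) :
    rescaled (reciprocalFun f) r b a z = -rescaled f r a b z := by
  by_cases h : z ∈ singularSet a b
  · rw [rescaled_of_mem h, rescaled_of_mem (singularSet_comm a b ▸ h), neg_zero]
  · rw [rescaled_of_notMem h, rescaled_of_notMem (singularSet_comm a b ▸ h), hf.desingularized_reciprocal hr, mul_comm (Psi r b z), mul_neg]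

lemma IsNuclear.contDiff_desingularized (hf : IsNuclear f r a b) (hr : 2 ≤ r) :
    ContDiff ℝ ∞ (desingularized f) := by
  refine contDiff_iff_contDiffAt.2 fun z => ?_
  by_cases hb : z - b ∈ Λ
  · have h := ((hf.reciprocal hr).contDiffAt_desingularized hr
      ((hf.reciprocal hr).sub_pole_notMem hr hb)).neg
    refine h.congr_of_eventuallyEq (Eventually.of_forall fun u => ?_)
    simp only [hf.desingularized_reciprocal hr, neg_neg]
  · exact hf.contDiffAt_desingularized hr hb

lemma IsNuclear.contDiff_rescaled (hf : IsNuclear f r a b) (hr : 2 ≤ r) :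
    ContDiff ℝ ∞ (rescaled f r a b) := by
  refine contDiff_iff_contDiffAt.2 fun z => ?_
  by_cases hb : z - b ∈ Λ
  · have h := ((hf.reciprocal hr).contDiffAt_rescaled hr
      ((hf.reciprocal hr).sub_pole_notMem hr hb)).neg
    refine h.congr_of_eventuallyEq (Eventually.of_forall fun u => ?_)
    simp only [hf.rescaled_reciprocal hr, neg_neg]
  · exact hf.contDiffAt_rescaled hr hb

lemma IsNuclear.desingularized_add (hf : IsNuclear f r a b) {w : ℂ} (hw : w ∈ Λ) (z : ℂ) :
    desingularized f (z + w) = desingularized f z := by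
  have h : (fun z => f (z + w)) = f := funext (hf.periodic w hw)
  have hd : deriv f (z + w) = deriv f z := by
    rw [← deriv_comp_add_const, h]
  simp only [desingularized, hf.order_add hw, hd, hf.periodic w hw]

lemma IsNuclear.rescaled_add (hf : IsNuclear f r a b) {w : ℂ} (hw : w ∈ Λ) (z : ℂ) :
    rescaled f r a b (z + w) = rescaled f r a b z := by
  have h : ∀ c, z + w - c ∈ Λ ↔ z - c ∈ Λ := fun c => by
    rw [add_sub_right_comm]
    exact ⟨fun h => by simpa using sub_mem h hw, fun h => add_mem h hw⟩
  classical
  unfold rescaled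
  exact if_congr (or_congr (h a) (h b)) rfl (by
    simp only [hf.desingularized_add hw, Psi_add_lattice_right r _ z hw])

lemma IsNuclear.lipschitzBounded_desingularized (hf : IsNuclear f r a b) (hr : 2 ≤ r) :
    LipschitzBounded (desingularized f) :=
  lipschitzBounded_of_periodic (hf.contDiff_desingularized hr) fun _ hw => hf.desingularized_add hw

lemma IsNuclear.lipschitzBounded_rescaled (hf : IsNuclear f r a b) (hr : 2 ≤ r) :
    LipschitzBounded (rescaled f r a b) :=
  lipschitzBounded_of_periodic (hf.contDiff_rescaled hr) fun _ hw => hf.rescaled_add hw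

end Nuclear

/-! ### Phase portrait, attractors and repellors -/

variable {f : ℂ → ℂ} {r : ℕ} {a b : ℂ}

lemma IsNuclear.samePhasePortrait (hf : IsNuclear f r a b) (hr : 2 ≤ r) :
    SamePhasePortrait (rescaled f r a b) (desingularized f) := by
  have hpos : ∀ z ∉ singularSet a b, 0 < Psi r a z * Psi r b z := fun z hz =>
    mul_pos (Psi_pos hr fun h => hz (Or.inl h)) (Psi_pos hr fun h => hz (Or.inr h))
  have hcont : ContinuousOn (fun z => Psi r a z * Psi r b z) (singularSet a b)ᶜ := fun z hz =>
    ((contDiffAt_Psi hr fun h => hz (Or.inl h)).mul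
      (contDiffAt_Psi hr fun h => hz (Or.inr h))).continuousAt.continuousWithinAt
  have hE := isClosed_singularSet a b
  have hX := hf.lipschitzBounded_rescaled hr
  have hY := hf.lipschitzBounded_desingularized hr
  constructor
  · exact trajectoriesSubset_of_smul hX hY hE hcont hpos (fun z hz => rescaled_of_mem hz)
      (fun z hz => hf.desingularized_eq_zero hr hz)
      fun z hz => by rw [rescaled_of_notMem hz, Complex.real_smul]
  · refine trajectoriesSubset_of_smul hY hX hE (hcont.inv₀ fun z hz => (hpos z hz).ne')
      (fun z hz => inv_pos.2 (hpos z hz)) (fun z hz => hf.desingularized_eq_zero hr hz)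
      (fun z hz => rescaled_of_mem hz) fun z hz => ?_
    rw [rescaled_of_notMem hz, ← Complex.real_smul, Pi.inv_apply, smul_smul,
      inv_mul_cancel₀ (hpos z hz).ne', one_smul]

lemma IsNuclear.isAttractor (hf : IsNuclear f r a b) (hr : 2 ≤ r) {p : ℂ} (hp : p - a ∈ Λ) :
    IsAttractor (rescaled f r a b) p := by
  obtain ⟨c, hc, hd⟩ := (hf.translate_zero hp).hasFDerivAt_rescaled_self hr
  rw [rescaled_translate_zero hp] at hd
  exact isAttractor_of_hasFDerivAt (hf.lipschitzBounded_rescaled hr)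
    (rescaled_of_mem (Or.inl hp)) hc hd

lemma IsNuclear.isHyperbolic (hf : IsNuclear f r a b) (hr : 2 ≤ r) {p : ℂ} (hp : p - a ∈ Λ) :
    IsHyperbolic (rescaled f r a b) p := by
  obtain ⟨c, hc, hd⟩ := (hf.translate_zero hp).hasFDerivAt_rescaled_self hr
  rw [rescaled_translate_zero hp] at hd
  exact isHyperbolic_of_hasFDerivAt (rescaled_of_mem (Or.inl hp)) (neg_ne_zero.2 hc.ne') hd

lemma IsNuclear.notMem_singularSet_of_integralCurve (hf : IsNuclear f r a b) (hr : 2 ≤ r)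
    {γ : ℝ → ℂ} (hγ : IsIntegralCurve γ (fun _ => rescaled f r a b))
    (h0 : γ 0 ∉ singularSet a b) (t : ℝ) : γ t ∉ singularSet a b := fun ht =>
  h0 (by
    rw [integralCurve_const (hf.lipschitzBounded_rescaled hr) hγ (rescaled_of_mem ht) 0]
    exact ht)

/-- `|f|` does not increase along the trajectories that avoid the zeros and poles. -/
lemma IsNuclear.antitone_norm_comp_integralCurve (hf : IsNuclear f r a b) (hr : 2 ≤ r)
    {γ : ℝ → ℂ} (hγ : IsIntegralCurve γ (fun _ => rescaled f r a b))
    (h0 : γ 0 ∉ singularSet a b) : Antitone fun t => ‖f (γ t)‖ ^ 2 := by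
  have hE := hf.notMem_singularSet_of_integralCurve hr hγ h0
  have hd : ∀ t, HasDerivAt (fun t => ‖f (γ t)‖ ^ 2)
      (2 * inner ℝ (f (γ t)) (deriv f (γ t) * rescaled f r a b (γ t))) t := fun t =>
    ((hf.analyticAt hr fun h => hE t (Or.inr h)).differentiableAt.hasDerivAt.comp t
      (hγ t)).norm_sq
  refine antitone_of_deriv_nonpos (fun t => (hd t).differentiableAt) fun t => ?_
  rw [(hd t).deriv]
  obtain ⟨ha, hb⟩ := not_or.1 (hE t)
  -- The image `f ∘ γ` has velocity a nonpositive real multiple of itself: it moves along a ray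
  -- towards `0`.
  have hs : deriv f (γ t) * rescaled f r a b (γ t) =
      (-(Psi r a (γ t) * Psi r b (γ t) * (1 + ‖f (γ t)‖ ^ 4)⁻¹ * ‖deriv f (γ t)‖ ^ 2)) •
        f (γ t) := by
    rw [rescaled_of_notMem (hE t), (hf.desingularized_eventuallyEq hr hb).self_of_nhds,
      Complex.real_smul]
    push_cast
    rw [← Complex.conj_mul']
    ring
  rw [hs, real_inner_smul_right, real_inner_self_eq_norm_sq]
  have h1 := Psi_pos hr ha
  have h2 := Psi_pos hr hb
  have h3 : 0 ≤ Psi r a (γ t) * Psi r b (γ t) * (1 + ‖f (γ t)‖ ^ 4)⁻¹ * ‖deriv f (γ t)‖ ^ 2 *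
    ‖f (γ t)‖ ^ 2 := by positivity
  linarith

/-- By the identity theorem on the connected plane, `f` would also equal the nonzero constant `f p`
near `a`, where its order would then be `0` instead of `r`. -/
lemma IsNuclear.not_eventually_const (hf : IsNuclear f r a b) (hr : 2 ≤ r) {p : ℂ}
    (hp : f p ≠ 0) : ¬ ∀ᶠ z in 𝓝 p, f z = f p := fun h => by
  have hm : MeromorphicOn (fun z => f z - f p) univ := fun z _ =>
    (hf.meromorphic z).sub (MeromorphicAt.const _ _)
  have htop : meromorphicOrderAt (fun z => f z - f p) p = ⊤ := by
    rw [meromorphicOrderAt_eq_top_iff]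
    filter_upwards [h.filter_mono nhdsWithin_le_nhds] with z hz
    rw [hz, sub_self]
  have htop' : meromorphicOrderAt (fun z => f z - f p) a = ⊤ := by
    by_contra hne
    exact hm.meromorphicOrderAt_ne_top_of_isPreconnected isPreconnected_univ (mem_univ a)
      (mem_univ p) hne htop
  rw [meromorphicOrderAt_eq_top_iff] at htop'
  have hc : meromorphicOrderAt f a = meromorphicOrderAt (fun _ => f p) a :=
    meromorphicOrderAt_congr (htop'.mono fun z hz => sub_eq_zero.1 hz)
  classical
  rw [hf.order_zero, meromorphicOrderAt_const, if_neg hp] at hc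
  have : (r : ℤ) = 0 := by exact_mod_cast hc
  omega

/-- The open mapping theorem: values of `f` near `p` fill a neighbourhood of `f p ≠ 0`, which lies
on the boundary of the disc of radius `‖f p‖`. -/
lemma IsNuclear.frequently_norm_lt (hf : IsNuclear f r a b) (hr : 2 ≤ r) {p : ℂ}
    (hp : p ∉ singularSet a b) : ∃ᶠ z in 𝓝 p, ‖f z‖ < ‖f p‖ := by
  obtain ⟨ha, hb⟩ := not_or.1 hp
  have h0 := hf.ne_zero hr ha hb
  rcases (hf.analyticAt hr hb).eventually_constant_or_nhds_le_map_nhds with h | h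
  · exact absurd h (hf.not_eventually_const hr h0)
  · have h1 : f p ∈ closure (Metric.ball (0 : ℂ) ‖f p‖) := by
      rw [closure_ball _ (norm_ne_zero_iff.2 h0)]
      simp
    have h2 := frequently_map.1 ((mem_closure_iff_frequently.1 h1).filter_mono h)
    exact h2.mono fun z hz => by simpa using hz

lemma IsNuclear.sub_mem_of_isAttractor (hf : IsNuclear f r a b) (hr : 2 ≤ r) {p : ℂ}
    (hatt : IsAttractor (rescaled f r a b) p) : p - a ∈ Λ := by
  by_contra ha
  -- Only convergence to `p` is needed, not stability, so the neighbourhood `U` may be the whole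
  -- plane.
  obtain ⟨V, hV, hVatt⟩ := hatt.2 univ univ_mem
  have hflow : ∀ q ∈ V, q ∉ singularSet a b → ∃ γ : ℝ → ℂ,
      (∀ t, γ t ∉ singularSet a b) ∧ Tendsto γ atTop (𝓝 p) ∧
        ∀ t, 0 ≤ t → ‖f (γ t)‖ ≤ ‖f q‖ := by
    intro q hq hqE
    obtain ⟨γ, hγ0, hγ⟩ := exists_integralCurve (hf.lipschitzBounded_rescaled hr) 0 q
    have h0 : γ 0 ∉ singularSet a b := hγ0 ▸ hqE
    refine ⟨γ, hf.notMem_singularSet_of_integralCurve hr hγ h0,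
      (hVatt univ γ (isMaximalTrajectory_univ hγ) (mem_univ 0) (hγ0 ▸ hq)).2.2, fun t ht => ?_⟩
    have h1 := hf.antitone_norm_comp_integralCurve hr hγ h0 ht
    simp only [hγ0] at h1
    exact (pow_le_pow_iff_left₀ (norm_nonneg _) (norm_nonneg _) two_ne_zero).1 h1
  by_cases hb : p - b ∈ Λ
  -- At a pole, convergence to `p` would force `|f|` to infinity along a trajectory on which it
  -- stays below its initial value.
  · have hne : ∀ᶠ q in 𝓝[≠] p, q ∈ V ∧ q ∉ singularSet a b := by
      filter_upwards [mem_nhdsWithin_of_mem_nhds hV, eventually_ne_sub_notMem_lattice a p,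
        eventually_ne_sub_notMem_lattice b p] with q h1 h2 h3
      exact ⟨h1, not_or.2 ⟨h2, h3⟩⟩
    obtain ⟨q, hqV, hqE⟩ := hne.exists
    obtain ⟨γ, hγE, hγp, hγf⟩ := hflow q hqV hqE
    have h1 : Tendsto γ atTop (𝓝[≠] p) :=
      tendsto_nhdsWithin_of_tendsto_nhds_of_eventually_within _ hγp
        (Eventually.of_forall fun t h => hγE t (by rw [h]; exact Or.inr hb))
    have h2 := tendsto_norm_atTop_iff_cobounded.2
      ((tendsto_cobounded_of_meromorphicOrderAt_neg ((hf.order_neg_iff hr p).2 hb)).comp h1)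
    obtain ⟨t, ht1, ht2⟩ := ((h2.eventually_gt_atTop ‖f q‖).and (eventually_ge_atTop 0)).exists
    exact absurd ht1 (not_lt.2 (hγf t ht2))
  · have hpE : p ∉ singularSet a b := not_or.2 ⟨ha, hb⟩
    -- A start `q` with `‖f q‖ < ‖f p‖` is contradictory: in the limit, monotonicity gives `‖f p‖ ≤
    -- ‖f q‖`.
    obtain ⟨q, hq, hqV, hqE⟩ := ((hf.frequently_norm_lt hr hpE).and_eventually
      ((eventually_mem_set.2 hV).and
        ((isClosed_singularSet a b).isOpen_compl.mem_nhds hpE))).exists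
    obtain ⟨γ, hγE, hγp, hγf⟩ := hflow q hqV hqE
    have h1 : Tendsto (fun t => ‖f (γ t)‖) atTop (𝓝 ‖f p‖) :=
      ((hf.analyticAt hr hb).continuousAt.tendsto.comp hγp).norm
    exact absurd hq (not_lt.2 (le_of_tendsto h1 (eventually_atTop.2 ⟨0, hγf⟩)))

lemma IsNuclear.isAttractor_iff (hf : IsNuclear f r a b) (hr : 2 ≤ r) (p : ℂ) :
    IsAttractor (rescaled f r a b) p ↔ p - a ∈ Λ :=
  ⟨hf.sub_mem_of_isAttractor hr, hf.isAttractor hr⟩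

lemma IsNuclear.neg_rescaled (hf : IsNuclear f r a b) (hr : 2 ≤ r) :
    (fun z => -rescaled f r a b z) = rescaled (reciprocalFun f) r b a :=
  funext fun z => (hf.rescaled_reciprocal hr z).symm

lemma IsNuclear.isRepellor_iff (hf : IsNuclear f r a b) (hr : 2 ≤ r) (p : ℂ) :
    IsRepellor (rescaled f r a b) p ↔ p - b ∈ Λ := by
  rw [IsRepellor, hf.neg_rescaled hr]
  exact (hf.reciprocal hr).isAttractor_iff hr p

lemma IsNuclear.isHyperbolic_pole (hf : IsNuclear f r a b) (hr : 2 ≤ r) {p : ℂ}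
    (hp : p - b ∈ Λ) : IsHyperbolic (rescaled f r a b) p := by
  obtain ⟨c, hc, hd⟩ := ((hf.reciprocal hr).translate_zero hp).hasFDerivAt_rescaled_self hr
  rw [rescaled_translate_zero hp, ← hf.neg_rescaled hr] at hd
  refine isHyperbolic_of_hasFDerivAt (rescaled_of_mem (Or.inr hp)) hc.ne' ?_
  have h := hd.fun_neg
  simp only [neg_neg] at h
  refine h.congr_fderiv ?_
  ext v
  simp

end NewtonFlow

theorem lemma3p4 (r : ℕ) (hr : 2 ≤ r) (a b : ℂ) (f : ℂ → ℂ) (hf : NewtonFlow.IsNuclear f r a b) :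
    -- the lattice sums under the square roots converge
    (∀ c z : ℂ, z - c ∉ NewtonFlow.Λ →
      Summable fun w : NewtonFlow.Λ => ‖z - c - (w : ℂ)‖ ^ (-(4 * (r : ℤ) - 4))) ∧
    -- the flow is smooth
    ContDiff ℝ ∞ (NewtonFlow.rescaled f r a b) ∧
    -- it has the phase portrait of the desingularized Newton flow
    NewtonFlow.SamePhasePortrait (NewtonFlow.rescaled f r a b) (NewtonFlow.desingularized f) ∧
    -- its attractors are the zeros of `f`, its repellors the poles of `f`
    (∀ p : ℂ, NewtonFlow.IsAttractor (NewtonFlow.rescaled f r a b) p ↔ p - a ∈ NewtonFlow.Λ) ∧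
    (∀ p : ℂ, NewtonFlow.IsRepellor (NewtonFlow.rescaled f r a b) p ↔ p - b ∈ NewtonFlow.Λ) ∧
    -- and all of them are hyperbolic
    (∀ p : ℂ, NewtonFlow.IsAttractor (NewtonFlow.rescaled f r a b) p ∨
        NewtonFlow.IsRepellor (NewtonFlow.rescaled f r a b) p →
      NewtonFlow.IsHyperbolic (NewtonFlow.rescaled f r a b) p) := by
  refine ⟨fun c z _ => ?_, hf.contDiff_rescaled hr, hf.samePhasePortrait hr,
    hf.isAttractor_iff hr, hf.isRepellor_iff hr, fun p hp => ?_⟩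
  · simp only [NewtonFlow.norm_zpow_eq (show 1 ≤ r by omega)]
    exact NewtonFlow.summable_inv_norm_pow (by omega) (z - c)
  · rcases hp with h | h
    · exact hf.isHyperbolic hr ((hf.isAttractor_iff hr p).1 h)
    · exact hf.isHyperbolic_pole hr ((hf.isRepellor_iff hr p).1 h)
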